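/- Let $L$ be a non-empty distributive lattice and let $L^*$ be the set of all lattice homomorphisms $\varphi:L\to[-1,1]$. For $x\in L$ let $\delta_x:L^*\to\mathbb R$, $\delta_x(\varphi)=\varphi(x)$. The free Banach lattice $\mathrm{FBL}\langle L\rangle$ generated by $L$ is the smallest closed vector sublattice containing $\{\delta_x:x\in L\}$ of the Banach lattice of all positively homogeneous functions $f:L^*\to\mathbb R$ (that is, $f(\lambda\varphi)=\lambda f(\varphi)$ whenever $\lambda\ge 0$ and $\varphi,\lambda\varphi\in L^*$) with $$\|f\|=\sup\Big\{\sum_{i=1}^m|f(\varphi_i)| : m\in\mathbb N,\ \varphi_1,\dots,\varphi_m\in L^*,\ \sup_{x\in L}\sum_{i=1}^m|\varphi_i(x)|\le 1\Big\}<\infty,$$ equipped with this norm and the pointwise order. A quasi-interior point of a Banach lattice $E$ is an element $u\ge 0$ of $E$ such that the ideal $\{x\in E: |x|\le cu \text{ for some } c\ge 0\}$ is norm dense in $E$. Call $S\subseteq L$ separating if for every non-zero $\varphi\in L^*$ there is $s\in S$ with $\varphi(s)\ne 0$. Theorem. $\mathrm{FBL}\langle L\rangle$ has a quasi-interior point if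 and only if $L$ has a countable separating subset. Moreover, for every sequence $(s_n)_{n\ge 1}$ in $L$ (repetitions allowed) whose set of terms is separating, the series $\sum_{n\ge 1}2^{-n}|\delta_{s_n}|$ converges in $\mathrm{FBL}\langle L\rangle$ and its sum is a quasi-interior point. -/

import Mathlib

universe u

noncomputable section

/-- A *quasi-interior point* of a Banach lattice `E`: a positive `p` whose principal ideal
`{x | |x| ≤ c • p for some c ≥ 0}` is norm dense in `E`. -/
def IsQuasiInteriorPoint {E : Type*} [NormedAddCommGroup E] [NormedSpace ℝ E] [CompleteSpace E]
    [Lattice E] [HasSolidNorm E] [IsOrderedAddMonoid E] [IsOrderedModule ℝ E] (p : E) : Prop :=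
  0 ≤ p ∧ Dense {x : E | ∃ c : ℝ, 0 ≤ c ∧ |x| ≤ c • p}

/-- The dual object `L^*`: all lattice homomorphisms `L → ℝ` with values in `[-1, 1]`. -/
def LatticeDual (L : Type u) [DistribLattice L] : Type u :=
  {φ : LatticeHom L ℝ // ∀ a, φ a ∈ Set.Icc (-1 : ℝ) 1}

namespace LatticeDual

variable {L : Type u} [DistribLattice L]

instance : CoeFun (LatticeDual L) (fun _ => L → ℝ) := ⟨fun φ => φ.1⟩

theorem abs_le_one (φ : LatticeDual L) (a : L) : |φ a| ≤ 1 := abs_le.2 (φ.2 a)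

/-- Positive homogeneity of a function on `L^*`: `f (c φ) = c f φ` whenever `c ≥ 0` and the
pointwise multiple `c φ` (called `ψ` below) belongs to `L^*`. -/
def PosHomogeneous (f : LatticeDual L → ℝ) : Prop :=
  ∀ (c : ℝ) (φ ψ : LatticeDual L), 0 ≤ c → (∀ a, ψ a = c * φ a) → f ψ = c * f φ

/-- The finite families `φ₁, …, φₘ` in `L^*` with `sup_{a ∈ L} ∑ |φᵢ a| ≤ 1`. -/
def Admissible {m : ℕ} (φ : Fin m → LatticeDual L) : Prop :=
  ∀ a : L, ∑ i, |φ i a| ≤ 1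

/-- The set of all sums `∑ |f φᵢ|` over admissible families; its supremum is the norm of `f`. -/
def normSums (f : LatticeDual L → ℝ) : Set ℝ :=
  {r | ∃ (m : ℕ) (φ : Fin m → LatticeDual L), Admissible φ ∧ r = ∑ i, |f (φ i)|}

theorem zero_mem_normSums (f : LatticeDual L → ℝ) : (0 : ℝ) ∈ normSums f :=
  ⟨0, Fin.elim0, fun a => by simp, by simp⟩

theorem bddAbove_of_le_add {f g h : LatticeDual L → ℝ} (hf : BddAbove (normSums f))
    (hg : BddAbove (normSums g)) (hh : ∀ φ, |h φ| ≤ |f φ| + |g φ|) :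
    BddAbove (normSums h) := by
  obtain ⟨A, hA⟩ := hf
  obtain ⟨B, hB⟩ := hg
  refine ⟨A + B, ?_⟩
  rintro r ⟨m, φ, hφ, rfl⟩
  calc ∑ i, |h (φ i)| ≤ ∑ i, (|f (φ i)| + |g (φ i)|) := Finset.sum_le_sum fun i _ => hh _
    _ = ∑ i, |f (φ i)| + ∑ i, |g (φ i)| := Finset.sum_add_distrib
    _ ≤ A + B := add_le_add (hA ⟨m, φ, hφ, rfl⟩) (hB ⟨m, φ, hφ, rfl⟩)

variable (L) in
/-- The positively homogeneous functions on `L^*` of finite norm, as a linear subspace of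
`ℝ^(L^*)`. -/
def boundedPosHom : Submodule ℝ (LatticeDual L → ℝ) where
  carrier := {f | PosHomogeneous f ∧ BddAbove (normSums f)}
  zero_mem' := by
    refine ⟨fun c φ ψ _ _ => by simp, 0, ?_⟩
    rintro r ⟨m, φ, _, rfl⟩
    simp
  add_mem' := by
    rintro f g ⟨hf, hf'⟩ ⟨hg, hg'⟩
    refine ⟨fun c φ ψ hc h => ?_, bddAbove_of_le_add hf' hg' fun φ => abs_add_le _ _⟩
    simp only [Pi.add_apply, hf c φ ψ hc h, hg c φ ψ hc h]
    ring
  smul_mem' := by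
    rintro t f ⟨hf, A, hA⟩
    refine ⟨fun c φ ψ hc h => ?_, |t| * A, ?_⟩
    · simp only [Pi.smul_apply, smul_eq_mul, hf c φ ψ hc h]
      ring
    · rintro r ⟨m, φ, hφ, rfl⟩
      simp only [Pi.smul_apply, smul_eq_mul, abs_mul, ← Finset.mul_sum]
      exact mul_le_mul_of_nonneg_left (hA ⟨m, φ, hφ, rfl⟩) (abs_nonneg t)

theorem sup_mem {f g : LatticeDual L → ℝ} (hf : f ∈ boundedPosHom L) (hg : g ∈ boundedPosHom L) :
    f ⊔ g ∈ boundedPosHom L := by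
  refine ⟨fun c φ ψ hc h => ?_, bddAbove_of_le_add hf.2 hg.2 fun φ => ?_⟩
  · simp only [Pi.sup_apply, hf.1 c φ ψ hc h, hg.1 c φ ψ hc h]
    exact (mul_max_of_nonneg _ _ hc).symm
  · rw [Pi.sup_apply]
    exact abs_max_le_max_abs_abs.trans (max_le_add_of_nonneg (abs_nonneg _) (abs_nonneg _))

theorem inf_mem {f g : LatticeDual L → ℝ} (hf : f ∈ boundedPosHom L) (hg : g ∈ boundedPosHom L) :
    f ⊓ g ∈ boundedPosHom L := by
  have h : f ⊓ g = -((-f) ⊔ (-g)) := by rw [neg_sup, neg_neg, neg_neg]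
  rw [h]
  exact neg_mem (sup_mem (neg_mem hf) (neg_mem hg))

theorem eval_mem (x : L) : (fun φ : LatticeDual L => φ x) ∈ boundedPosHom L := by
  refine ⟨fun c φ ψ _ h => h x, 1, ?_⟩
  rintro r ⟨m, φ, hφ, rfl⟩
  exact hφ x

end LatticeDual

open LatticeDual

/-- The space of positively homogeneous functions of finite norm on `L^*`, with pointwise linear
and lattice operations and the norm `‖f‖ = sup ∑ |f φᵢ|` over all admissible families. (It is not
given the topology of pointwise convergence, whence the type synonym.) -/
def PosHomSpace (L : Type u) [DistribLattice L] : Type u := boundedPosHom L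

namespace PosHomSpace

variable {L : Type u} [DistribLattice L]

instance : AddCommGroup (PosHomSpace L) := inferInstanceAs (AddCommGroup (boundedPosHom L))

instance : Module ℝ (PosHomSpace L) := inferInstanceAs (Module ℝ (boundedPosHom L))

instance : Lattice (PosHomSpace L) :=
  Subtype.lattice (P := fun f => f ∈ boundedPosHom L) (fun _ _ hf hg => sup_mem hf hg)
    (fun _ _ hf hg => inf_mem hf hg)

instance : FunLike (PosHomSpace L) (LatticeDual L) ℝ where
  coe f := f.1
  coe_injective _ _ h := Subtype.ext h

/-- Bundle a function as an element of the space. -/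
def ofFun (f : LatticeDual L → ℝ) (h : f ∈ boundedPosHom L) : PosHomSpace L := ⟨f, h⟩

@[simp] theorem ofFun_apply (f : LatticeDual L → ℝ) (h : f ∈ boundedPosHom L)
    (φ : LatticeDual L) : ofFun f h φ = f φ := rfl

theorem mem_boundedPosHom (f : PosHomSpace L) : (f : LatticeDual L → ℝ) ∈ boundedPosHom L := f.2

@[ext] theorem ext {f g : PosHomSpace L} (h : ∀ φ, f φ = g φ) : f = g :=
  DFunLike.ext f g h

@[simp] theorem zero_apply (φ : LatticeDual L) : (0 : PosHomSpace L) φ = 0 := rfl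
@[simp] theorem add_apply (f g : PosHomSpace L) (φ : LatticeDual L) : (f + g) φ = f φ + g φ := rfl
@[simp] theorem neg_apply (f : PosHomSpace L) (φ : LatticeDual L) : (-f) φ = -f φ := rfl
@[simp] theorem sub_apply (f g : PosHomSpace L) (φ : LatticeDual L) : (f - g) φ = f φ - g φ := rfl
@[simp] theorem smul_apply (c : ℝ) (f : PosHomSpace L) (φ : LatticeDual L) :
    (c • f) φ = c * f φ := rfl
@[simp] theorem sup_apply (f g : PosHomSpace L) (φ : LatticeDual L) :
    (f ⊔ g) φ = f φ ⊔ g φ := rfl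
@[simp] theorem inf_apply (f g : PosHomSpace L) (φ : LatticeDual L) :
    (f ⊓ g) φ = f φ ⊓ g φ := rfl
@[simp] theorem abs_apply (f : PosHomSpace L) (φ : LatticeDual L) : |f| φ = |f φ| := rfl
theorem le_def {f g : PosHomSpace L} : f ≤ g ↔ ∀ φ, f φ ≤ g φ := Iff.rfl

instance : IsOrderedAddMonoid (PosHomSpace L) where
  add_le_add_left _ _ h f := le_def.2 fun φ => add_le_add_left (le_def.1 h φ) (f φ)

instance : IsOrderedModule ℝ (PosHomSpace L) where
  smul_le_smul_of_nonneg_left _ hc _ _ h :=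
    le_def.2 fun φ => mul_le_mul_of_nonneg_left (le_def.1 h φ) hc
  smul_le_smul_of_nonneg_right _ hf _ _ h :=
    le_def.2 fun φ => mul_le_mul_of_nonneg_right h (le_def.1 hf φ)

/-- The norm, as a supremum of a nonempty set that is bounded above by the very definition of the
space. -/
def normFn (f : PosHomSpace L) : ℝ := sSup (normSums f)

theorem sum_le_normFn (f : PosHomSpace L) {m : ℕ} {φ : Fin m → LatticeDual L}
    (hφ : Admissible φ) : ∑ i, |f (φ i)| ≤ normFn f :=
  le_csSup f.mem_boundedPosHom.2 ⟨m, φ, hφ, rfl⟩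

theorem normFn_le {f : PosHomSpace L} {C : ℝ}
    (h : ∀ (m : ℕ) (φ : Fin m → LatticeDual L), Admissible φ → ∑ i, |f (φ i)| ≤ C) :
    normFn f ≤ C := by
  refine csSup_le ⟨0, zero_mem_normSums _⟩ ?_
  rintro r ⟨m, φ, hφ, rfl⟩
  exact h m φ hφ

theorem abs_apply_le_normFn (f : PosHomSpace L) (φ : LatticeDual L) : |f φ| ≤ normFn f := by
  simpa using sum_le_normFn f (m := 1) (φ := fun _ => φ) fun a => by simpa using φ.abs_le_one a

instance : NormedAddCommGroup (PosHomSpace L) :=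
  AddGroupNorm.toNormedAddCommGroup
    { toFun := normFn
      map_zero' := le_antisymm (normFn_le fun m φ _ => by simp)
        (le_csSup (0 : PosHomSpace L).mem_boundedPosHom.2 (zero_mem_normSums _))
      add_le' := fun f g => normFn_le fun m φ hφ =>
        calc ∑ i, |(f + g) (φ i)| ≤ ∑ i, (|f (φ i)| + |g (φ i)|) :=
              Finset.sum_le_sum fun i _ => abs_add_le _ _
          _ = ∑ i, |f (φ i)| + ∑ i, |g (φ i)| := Finset.sum_add_distrib
          _ ≤ normFn f + normFn g := add_le_add (sum_le_normFn f hφ) (sum_le_normFn g hφ)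
      neg' := fun f => by
        have : normSums (-f : PosHomSpace L) = normSums f := by
          ext r
          refine exists_congr fun m => exists_congr fun φ => and_congr_right fun _ => ?_
          have h : ∀ i, |(-f) (φ i)| = |f (φ i)| := fun i => abs_neg _
          simp only [h]
        simp only [normFn, this]
      eq_zero_of_map_eq_zero' := fun f hf => by
        ext φ
        exact abs_nonpos_iff.1 ((abs_apply_le_normFn f φ).trans hf.le) }

theorem norm_def (f : PosHomSpace L) : ‖f‖ = sSup (normSums f) := rfl

instance : NormedSpace ℝ (PosHomSpace L) where
  norm_smul_le c f := normFn_le fun m φ hφ => by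
    simp only [smul_apply, abs_mul, ← Finset.mul_sum]
    exact mul_le_mul_of_nonneg_left (sum_le_normFn f hφ) (abs_nonneg c)

instance : HasSolidNorm (PosHomSpace L) where
  solid _ g h := normFn_le fun _ φ hφ =>
    (Finset.sum_le_sum fun i _ => le_def.1 h (φ i)).trans (sum_le_normFn g hφ)

instance : CompleteSpace (PosHomSpace L) := by
  refine Metric.complete_of_cauchySeq_tendsto fun F hF => ?_
  have hpt : ∀ φ, ∃ l, Filter.Tendsto (fun n => F n φ) Filter.atTop (nhds l) := fun φ => by
    refine cauchySeq_tendsto_of_complete (Metric.cauchySeq_iff.2 fun ε hε => ?_)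
    obtain ⟨N, hN⟩ := Metric.cauchySeq_iff.1 hF ε hε
    refine ⟨N, fun m hm n hn => lt_of_le_of_lt ?_ (hN m hm n hn)⟩
    rw [dist_eq_norm, dist_eq_norm, Real.norm_eq_abs]
    exact abs_apply_le_normFn (F m - F n) φ
  choose g hg using hpt
  have key : ∀ ε > 0, ∃ N, ∀ n ≥ N, ∀ (m : ℕ) (φ : Fin m → LatticeDual L), Admissible φ →
      ∑ i, |F n (φ i) - g (φ i)| ≤ ε := fun ε hε => by
    obtain ⟨N, hN⟩ := Metric.cauchySeq_iff.1 hF ε hε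
    refine ⟨N, fun n hn m φ hφ => ?_⟩
    have ht : Filter.Tendsto (fun k => ∑ i, |F n (φ i) - F k (φ i)|) Filter.atTop
        (nhds (∑ i, |F n (φ i) - g (φ i)|)) :=
      tendsto_finsetSum _ fun i _ => ((tendsto_const_nhds).sub (hg (φ i))).abs
    refine le_of_tendsto ht (Filter.eventually_atTop.2 ⟨N, fun k hk => ?_⟩)
    have h1 := hN n hn k hk
    rw [dist_eq_norm] at h1
    exact (sum_le_normFn (F n - F k) hφ).trans h1.le
  have hmem : g ∈ boundedPosHom L := by
    refine ⟨fun c φ ψ hc h => ?_, ?_⟩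
    · refine tendsto_nhds_unique (hg ψ) ?_
      have : (fun n => F n ψ) = fun n => c * F n φ := funext fun n => (F n).mem_boundedPosHom.1 c φ ψ hc h
      rw [this]
      exact (hg φ).const_mul c
    · obtain ⟨N, hN⟩ := key 1 one_pos
      refine ⟨‖F N‖ + 1, ?_⟩
      rintro r ⟨m, φ, hφ, rfl⟩
      calc ∑ i, |g (φ i)| ≤ ∑ i, (|F N (φ i)| + |F N (φ i) - g (φ i)|) :=
            Finset.sum_le_sum fun i _ => by
              have := abs_sub (F N (φ i)) (F N (φ i) - g (φ i))
              rwa [sub_sub_cancel] at this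
        _ = ∑ i, |F N (φ i)| + ∑ i, |F N (φ i) - g (φ i)| := Finset.sum_add_distrib
        _ ≤ ‖F N‖ + 1 := add_le_add (sum_le_normFn (F N) hφ) (hN N le_rfl m φ hφ)
  refine ⟨ofFun g hmem, Metric.tendsto_atTop.2 fun ε hε => ?_⟩
  obtain ⟨N, hN⟩ := key (ε / 2) (half_pos hε)
  refine ⟨N, fun n hn => lt_of_le_of_lt ?_ (half_lt_self hε)⟩
  rw [dist_eq_norm]
  exact normFn_le fun m φ hφ => hN n hn m φ hφ

/-- The evaluation `δ_x : φ ↦ φ x`. -/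
def eval (x : L) : PosHomSpace L := ofFun (fun φ => φ x) (eval_mem x)

@[simp] theorem eval_apply (x : L) (φ : LatticeDual L) : eval x φ = φ x := rfl

/-- Closed vector sublattices of the space of positively homogeneous functions of finite norm. -/
def IsClosedVectorSublattice (M : Submodule ℝ (PosHomSpace L)) : Prop :=
  IsClosed (M : Set (PosHomSpace L)) ∧ ∀ f ∈ M, ∀ g ∈ M, f ⊔ g ∈ M

end PosHomSpace

open PosHomSpace

/-- The free Banach lattice `FBL⟨L⟩` generated by the distributive lattice `L`: the Banach lattice
generated by the evaluations `δ_x`, `x ∈ L`, i.e. the smallest closed vector sublattice that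
contains them all. -/
def FBL (L : Type u) [DistribLattice L] : Submodule ℝ (PosHomSpace L) :=
  sInf {M | IsClosedVectorSublattice M ∧ ∀ x : L, eval x ∈ M}

namespace FBL

variable {L : Type u} [DistribLattice L]

theorem mem_iff {f : PosHomSpace L} :
    f ∈ FBL L ↔ ∀ M, IsClosedVectorSublattice M → (∀ x : L, eval x ∈ M) → f ∈ M := by
  simp only [FBL, Submodule.mem_sInf, Set.mem_ofPred_eq, and_imp]

theorem isClosedVectorSublattice : IsClosedVectorSublattice (FBL L) := by
  refine ⟨?_, fun f hf g hg => mem_iff.2 fun M hM hx =>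
    hM.2 f (mem_iff.1 hf M hM hx) g (mem_iff.1 hg M hM hx)⟩
  have : (FBL L : Set (PosHomSpace L)) =
      ⋂ M ∈ {M | IsClosedVectorSublattice M ∧ ∀ x : L, eval x ∈ M}, (M : Set (PosHomSpace L)) :=
    Submodule.coe_sInf _
  rw [this]
  exact isClosed_biInter fun M hM => hM.1.1

theorem sup_mem {f g : PosHomSpace L} (hf : f ∈ FBL L) (hg : g ∈ FBL L) : f ⊔ g ∈ FBL L :=
  isClosedVectorSublattice.2 f hf g hg

theorem inf_mem {f g : PosHomSpace L} (hf : f ∈ FBL L) (hg : g ∈ FBL L) : f ⊓ g ∈ FBL L := by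
  have h : f ⊓ g = -((-f) ⊔ (-g)) := by rw [neg_sup, neg_neg, neg_neg]
  rw [h]
  exact neg_mem (sup_mem (neg_mem hf) (neg_mem hg))

/-- The lattice operations of `FBL⟨L⟩` are the pointwise ones. -/
instance : Lattice (FBL L) :=
  Subtype.lattice (P := fun f => f ∈ FBL L) (fun _ _ hf hg => sup_mem hf hg)
    (fun _ _ hf hg => inf_mem hf hg)

@[simp] theorem coe_sup (f g : FBL L) : ((f ⊔ g : FBL L) : PosHomSpace L) = ↑f ⊔ ↑g := rfl
@[simp] theorem coe_inf (f g : FBL L) : ((f ⊓ g : FBL L) : PosHomSpace L) = ↑f ⊓ ↑g := rfl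
@[simp] theorem coe_abs (f : FBL L) : ((|f| : FBL L) : PosHomSpace L) = |(f : PosHomSpace L)| := rfl

instance : IsOrderedAddMonoid (FBL L) where
  add_le_add_left _ _ h f := add_le_add_left (α := PosHomSpace L) h f.1

instance : IsOrderedModule ℝ (FBL L) where
  smul_le_smul_of_nonneg_left _ hc f g h :=
    smul_le_smul_of_nonneg_left (α := ℝ) (β := PosHomSpace L) (b₁ := f.1) (b₂ := g.1) h hc
  smul_le_smul_of_nonneg_right f hf _ _ h :=
    smul_le_smul_of_nonneg_right (α := ℝ) (β := PosHomSpace L) (b := f.1) h hf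

instance : HasSolidNorm (FBL L) where
  solid f g h := HasSolidNorm.solid (α := PosHomSpace L) (x := f.1) (y := g.1)
    (by rw [← coe_abs, ← coe_abs]; exact h)

instance : CompleteSpace (FBL L) :=
  isClosedVectorSublattice.1.completeSpace_coe

/-- The canonical lattice homomorphism `δ : L → FBL⟨L⟩`, `x ↦ δ_x`. -/
def δ : LatticeHom L (FBL L) where
  toFun x := ⟨eval x, mem_iff.2 fun _ _ h => h x⟩
  map_sup' x y := Subtype.ext (PosHomSpace.ext fun φ => map_sup φ.1 x y)
  map_inf' x y := Subtype.ext (PosHomSpace.ext fun φ => map_inf φ.1 x y)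

end FBL

/-- A subset `S` of `L` is *separating* if every non-zero `φ ∈ L^*` is non-zero at some point
of `S`. -/
def IsSeparatingSubset {L : Type u} [DistribLattice L] (S : Set L) : Prop :=
  ∀ φ : LatticeDual L, (∃ a : L, φ a ≠ 0) → ∃ s ∈ S, φ s ≠ 0

end

/-! Necessity: every element of `FBL L` is a norm limit of lattice-linear expressions in
evaluations, so it vanishes wherever some countable set of points is sent to `0`. If `φ` kills such
a set for a quasi-interior `p`, the whole ideal of `p` vanishes at `φ`; by density so does every `δ
a`, and `φ = 0`. Sufficiency rests on two facts. The norm lies between the sup norm and four times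
it (`norm_le_of_abs_apply_le`), so uniform approximation suffices. And `L^*` is pointwise compact:
if no multiple of `p` dominated `|δ_x|` up to `ε`, a limit of counterexamples would be non-zero at
`x` yet vanish on the separating sequence (`eval_mem_almostDominated`). Almost domination passes
from evaluations to all of `FBL L`, and truncating at `±k • p` then gives density. -/

open Filter Topology LatticeDual PosHomSpace

/-! ### Admissible families and compactness of `L^*` -/

namespace LatticeDual

variable {L : Type u} [DistribLattice L]

/-- Along an admissible family one may evaluate every member at a different point, at the cost of
a factor `2`: all the values lie between those at the supremum and the infimum of the points. -/
theorem Admissible.sum_abs_apply_le_two {m : ℕ} {φ : Fin m → LatticeDual L} (hφ : Admissible φ)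
    (a : Fin m → L) : ∑ i, |φ i (a i)| ≤ 2 := by
  rcases isEmpty_or_nonempty (Fin m) with h | h
  · simp
  have hne : (Finset.univ : Finset (Fin m)).Nonempty := Finset.univ_nonempty
  set u := Finset.univ.sup' hne a
  set v := Finset.univ.inf' hne a
  calc ∑ i, |φ i (a i)| ≤ ∑ i, (|φ i u| + |φ i v|) := Finset.sum_le_sum fun i _ => by
        have h1 : φ i (a i) ≤ φ i u :=
          OrderHomClass.mono (φ i).1 (Finset.le_sup' a (Finset.mem_univ i))
        have h2 : φ i v ≤ φ i (a i) :=
          OrderHomClass.mono (φ i).1 (Finset.inf'_le a (Finset.mem_univ i))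
        rw [abs_le]
        constructor
        · linarith [neg_abs_le (φ i v), abs_nonneg (φ i u)]
        · linarith [le_abs_self (φ i u), abs_nonneg (φ i v)]
    _ = ∑ i, |φ i u| + ∑ i, |φ i v| := Finset.sum_add_distrib
    _ ≤ 2 := by linarith [hφ u, hφ v]

/-- The pointwise multiple of an element of `L^*` by a non-negative scalar, provided that it is
again bounded by `1`. -/
def rescale (φ : LatticeDual L) (c : ℝ) (hc : 0 ≤ c) (h : ∀ a, |c * φ a| ≤ 1) :
    LatticeDual L :=
  ⟨{ toFun := fun a => c * φ a
     map_sup' := fun a b => by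
       rw [show φ (a ⊔ b) = φ a ⊔ φ b from map_sup φ.1 a b]
       exact mul_max_of_nonneg _ _ hc
     map_inf' := fun a b => by
       rw [show φ (a ⊓ b) = φ a ⊓ φ b from map_inf φ.1 a b]
       exact mul_min_of_nonneg _ _ hc }, fun a => abs_le.1 (h a)⟩

theorem rescale_apply (φ : LatticeDual L) (c : ℝ) (hc : 0 ≤ c) (h : ∀ a, |c * φ a| ≤ 1) (a : L) :
    rescale φ c hc h a = c * φ a := rfl

/-- Compactness of `L^*`: every sequence converges pointwise along the ultrafilter
`hyperfilter ℕ`. -/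
theorem exists_tendsto_hyperfilter (φ : ℕ → LatticeDual L) :
    ∃ ψ : LatticeDual L, ∀ a, Tendsto (fun k => φ k a) (hyperfilter ℕ) (𝓝 (ψ a)) := by
  have h : ∀ a, ∃ l ∈ Set.Icc (-1 : ℝ) 1, Tendsto (fun k => φ k a) (hyperfilter ℕ) (𝓝 l) :=
    fun a => isCompact_Icc.ultrafilter_le_nhds ((hyperfilter ℕ).map fun k => φ k a)
      (le_principal_iff.2 (Ultrafilter.mem_map.2 (univ_mem' fun n => (φ n).2 a)))
  choose g hg1 hg using h
  refine ⟨⟨⟨⟨g, fun a b => ?_⟩, fun a b => ?_⟩, hg1⟩, hg⟩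
  · refine tendsto_nhds_unique (hg (a ⊔ b)) (((hg a).sup_nhds (hg b)).congr fun k => ?_)
    exact (map_sup (φ k).1 a b).symm
  · refine tendsto_nhds_unique (hg (a ⊓ b)) (((hg a).inf_nhds (hg b)).congr fun k => ?_)
    exact (map_inf (φ k).1 a b).symm

end LatticeDual

/-! ### Comparison with the sup norm -/

namespace PosHomSpace

variable {L : Type u} [DistribLattice L]

theorem abs_apply_le_norm (f : PosHomSpace L) (φ : LatticeDual L) : |f φ| ≤ ‖f‖ :=
  abs_apply_le_normFn f φ

/-- Homogeneity turns the uniform bound into one proportional to `t = ⨆ a, |φ a|`. The supremum need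
not be attained, so `a` is chosen with `|φ a| > t / 2`, which costs the factor `2`. -/
theorem exists_abs_apply_le [Nonempty L] {f : PosHomSpace L} {ε : ℝ} (hε : 0 ≤ ε)
    (h : ∀ φ, |f φ| ≤ ε) (φ : LatticeDual L) : ∃ a, |f φ| ≤ 2 * ε * |φ a| := by
  have hbdd : BddAbove (Set.range fun a => |φ a|) :=
    ⟨1, by rintro _ ⟨a, rfl⟩; exact φ.abs_le_one a⟩
  set t := ⨆ a, |φ a|
  have hle : ∀ a, |φ a| ≤ t := fun a => le_ciSup hbdd a
  have ht0 : 0 ≤ t := (abs_nonneg _).trans (hle (Classical.arbitrary L))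
  rcases ht0.eq_or_lt with ht | ht
  · refine ⟨Classical.arbitrary L, ?_⟩
    -- Here `φ = 0`, and homogeneity with factor `0` forces `f φ = 0`.
    have h0 : ∀ a, φ a = 0 * φ a := fun a => by
      rw [zero_mul]
      exact abs_nonpos_iff.1 (ht ▸ hle a)
    rw [f.mem_boundedPosHom.1 0 φ φ le_rfl h0, zero_mul, abs_zero]
    positivity
  · obtain ⟨a, ha⟩ := exists_lt_of_lt_ciSup (half_lt_self ht)
    refine ⟨a, ?_⟩
    have hψ : ∀ b, |t⁻¹ * φ b| ≤ 1 := fun b => by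
      rw [abs_mul, abs_of_pos (inv_pos.2 ht), inv_mul_le_iff₀ ht, mul_one]
      exact hle b
    have hf := f.mem_boundedPosHom.1 t (rescale φ t⁻¹ (inv_nonneg.2 ht0) hψ) φ ht0 fun b => by
      rw [rescale_apply, mul_inv_cancel_left₀ ht.ne']
    rw [hf, abs_mul, abs_of_pos ht]
    nlinarith [mul_le_mul_of_nonneg_left (h (rescale φ t⁻¹ (inv_nonneg.2 ht0) hψ)) ht0]

/-- The norm is equivalent to the supremum norm. -/
theorem norm_le_of_abs_apply_le [Nonempty L] {f : PosHomSpace L} {ε : ℝ} (hε : 0 ≤ ε)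
    (h : ∀ φ, |f φ| ≤ ε) : ‖f‖ ≤ 4 * ε := by
  refine normFn_le fun m φ hφ => ?_
  choose a ha using exists_abs_apply_le hε h
  calc ∑ i, |f (φ i)| ≤ ∑ i, 2 * ε * |φ i (a (φ i))| := Finset.sum_le_sum fun i _ => ha _
    _ = 2 * ε * ∑ i, |φ i (a (φ i))| := by rw [Finset.mul_sum]
    _ ≤ 2 * ε * 2 := by
        gcongr
        exact hφ.sum_abs_apply_le_two _
    _ = 4 * ε := by ring

/-! ### Two closed vector sublattices -/

variable (L) in
/-- The functions that are determined by countably many points of `L`, to the extent that they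
vanish wherever all these points are mapped to `0`. -/
def countablyDetermined : Submodule ℝ (PosHomSpace L) where
  carrier := {f | ∃ S : Set L, S.Countable ∧
    ∀ φ : LatticeDual L, (∀ s ∈ S, φ s = 0) → f φ = 0}
  zero_mem' := ⟨∅, Set.countable_empty, fun _ _ => rfl⟩
  add_mem' := by
    rintro f g ⟨S, hS, hf⟩ ⟨T, hT, hg⟩
    refine ⟨S ∪ T, hS.union hT, fun φ h => ?_⟩
    rw [add_apply, hf φ fun s hs => h s (Or.inl hs), hg φ fun s hs => h s (Or.inr hs), add_zero]
  smul_mem' := by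
    rintro c f ⟨S, hS, hf⟩
    exact ⟨S, hS, fun φ h => by rw [smul_apply, hf φ h, mul_zero]⟩

/-- Closed because norm limits are pointwise limits and a countable union of countable sets is
countable. -/
theorem isClosedVectorSublattice_countablyDetermined :
    IsClosedVectorSublattice (countablyDetermined L) := by
  constructor
  · refine IsSeqClosed.isClosed fun F f hF hf => ?_
    choose S hS hSF using hF
    refine ⟨⋃ n, S n, Set.countable_iUnion hS, fun φ h => ?_⟩
    have h0 : ∀ n, F n φ = 0 := fun n => hSF n φ fun s hs => h s (Set.mem_iUnion.2 ⟨n, hs⟩)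
    refine abs_nonpos_iff.1 (ge_of_tendsto' (tendsto_iff_norm_sub_tendsto_zero.1 hf) fun n => ?_)
    simpa [h0 n] using abs_apply_le_norm (F n - f) φ
  · rintro f ⟨S, hS, hf⟩ g ⟨T, hT, hg⟩
    refine ⟨S ∪ T, hS.union hT, fun φ h => ?_⟩
    rw [sup_apply, hf φ fun s hs => h s (Or.inl hs), hg φ fun s hs => h s (Or.inr hs), sup_idem]

/-- The functions which are dominated by multiples of `p` up to arbitrarily small uniform
errors. -/
def almostDominated (p : PosHomSpace L) : Submodule ℝ (PosHomSpace L) where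
  carrier := {f | ∀ ε > 0, ∃ k : ℝ, 0 ≤ k ∧ ∀ φ, |f φ| ≤ k * p φ + ε}
  zero_mem' := fun ε hε => ⟨0, le_rfl, fun φ => by simpa using hε.le⟩
  add_mem' := by
    intro f g hf hg ε hε
    obtain ⟨k, hk, hkf⟩ := hf (ε / 2) (half_pos hε)
    obtain ⟨l, hl, hlg⟩ := hg (ε / 2) (half_pos hε)
    refine ⟨k + l, add_nonneg hk hl, fun φ => ?_⟩
    rw [add_apply]
    linarith [abs_add_le (f φ) (g φ), hkf φ, hlg φ]
  smul_mem' := by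
    intro c f hf ε hε
    -- The `+ 1` covers `c = 0`.
    obtain ⟨k, hk, hkf⟩ := hf (ε / (|c| + 1)) (by positivity)
    refine ⟨|c| * k, by positivity, fun φ => ?_⟩
    rw [smul_apply, abs_mul]
    have h1 : |c| * (ε / (|c| + 1)) ≤ ε := by
      rw [mul_div_assoc', div_le_iff₀ (by positivity)]
      linarith
    linarith [mul_le_mul_of_nonneg_left (hkf φ) (abs_nonneg c)]

theorem isClosedVectorSublattice_almostDominated (p : PosHomSpace L) (hp : 0 ≤ p) :
    IsClosedVectorSublattice (almostDominated p) := by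
  constructor
  · refine isClosed_of_closure_subset fun f hf ε hε => ?_
    obtain ⟨g, hg, hfg⟩ := Metric.mem_closure_iff.1 hf (ε / 2) (half_pos hε)
    obtain ⟨k, hk, hkg⟩ := hg (ε / 2) (half_pos hε)
    refine ⟨k, hk, fun φ => ?_⟩
    rw [dist_eq_norm] at hfg
    have h1 := abs_apply_le_norm (f - g) φ
    rw [sub_apply] at h1
    linarith [hkg φ, abs_sub_abs_le_abs_sub (f φ) (g φ)]
  · intro f hf g hg ε hε
    obtain ⟨k, hk, hkf⟩ := hf ε hε
    obtain ⟨l, hl, hlg⟩ := hg ε hε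
    refine ⟨k + l, add_nonneg hk hl, fun φ => ?_⟩
    have hpφ : 0 ≤ p φ := le_def.1 hp φ
    refine abs_max_le_max_abs_abs.trans (max_le ?_ ?_)
    · exact (hkf φ).trans (by nlinarith)
    · exact (hlg φ).trans (by nlinarith)

/-- If `p` has no zeros besides the zero of `L^*`, in the quantitative form that it dominates
multiples of evaluations at a separating sequence, then it almost dominates all evaluations. -/
theorem eval_mem_almostDominated {p : PosHomSpace L} (hp : 0 ≤ p) {s : ℕ → L}
    (hs : IsSeparatingSubset (Set.range s))
    (hsp : ∀ n, ∃ c : ℝ, ∀ φ, |φ (s n)| ≤ c * p φ) (x : L) :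
    eval x ∈ almostDominated p := by
  intro ε hε
  by_contra! hcon
  choose φ hφ using fun k : ℕ => hcon (k : ℝ) k.cast_nonneg
  obtain ⟨ψ, hψ⟩ := exists_tendsto_hyperfilter φ
  have hp0 : ∀ k, 0 ≤ p (φ k) := fun k => le_def.1 hp (φ k)
  -- Only `p (φ k) → 0` is needed; `p` is never evaluated at `ψ`, so its continuity plays no role.
  have hple : ∀ k : ℕ, 0 < k → p (φ k) ≤ 1 / (k : ℝ) := fun k hk => by
    rw [le_div_iff₀ (by exact_mod_cast hk)]
    have := hφ k
    rw [eval_apply] at this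
    linarith [(φ k).abs_le_one x]
  have hlim : Tendsto (fun k => p (φ k)) (hyperfilter ℕ) (𝓝 0) := by
    refine Tendsto.mono_left ?_ Nat.hyperfilter_le_atTop
    exact tendsto_of_tendsto_of_tendsto_of_le_of_le' tendsto_const_nhds
      tendsto_one_div_atTop_nhds_zero_nat (Eventually.of_forall hp0)
      ((eventually_gt_atTop 0).mono hple)
  have hx : ε ≤ |ψ x| := ge_of_tendsto' (hψ x).abs fun k => by
    have := hφ k
    rw [eval_apply] at this
    nlinarith [mul_nonneg (Nat.cast_nonneg (α := ℝ) k) (hp0 k)]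
  obtain ⟨_, ⟨n, rfl⟩, hn⟩ := hs ψ ⟨x, fun h => by simp [h] at hx; linarith⟩
  obtain ⟨c, hc⟩ := hsp n
  refine hn (abs_nonpos_iff.1 ?_)
  simpa using le_of_tendsto_of_tendsto' (hψ (s n)).abs (hlim.const_mul c) fun k => hc (φ k)

end PosHomSpace

/-! ### Quasi-interior points of `FBL L` -/

namespace FBL

variable {L : Type u} [DistribLattice L]

/-- A positive element of `FBL⟨L⟩` that almost dominates all evaluations is a quasi-interior
point. -/
theorem isQuasiInteriorPoint_of_eval_mem [Nonempty L] {p : FBL L} (hp : 0 ≤ p)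
    (h : ∀ x, eval x ∈ almostDominated (p : PosHomSpace L)) : IsQuasiInteriorPoint p := by
  refine ⟨hp, fun f => Metric.mem_closure_iff.2 fun ε hε => ?_⟩
  obtain ⟨k, hk, hkf⟩ := mem_iff.1 f.2 _ (isClosedVectorSublattice_almostDominated _ hp) h
    (ε / 8) (by positivity)
  have hkp : 0 ≤ k • p := smul_nonneg hk hp
  -- Truncating `f` to `[-k • p, k • p]` moves it by at most `ε / 8` pointwise, hence by at most `ε
  -- / 2` in norm.
  refine ⟨(f ⊓ k • p) ⊔ -(k • p), ⟨k, hk, ?_⟩, ?_⟩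
  · exact abs_le'.2 ⟨sup_le inf_le_right ((neg_nonpos.2 hkp).trans hkp), neg_le.1 le_sup_right⟩
  · rw [dist_eq_norm]
    have hnorm : ‖((f - ((f ⊓ k • p) ⊔ -(k • p)) : FBL L) : PosHomSpace L)‖ ≤ 4 * (ε / 8) := by
      refine norm_le_of_abs_apply_le (by positivity) fun φ => ?_
      have h1 := abs_le.1 (hkf φ)
      have hpφ : 0 ≤ k * (p : PosHomSpace L) φ := mul_nonneg hk (le_def.1 hp φ)
      change |(f : PosHomSpace L) φ - max (min ((f : PosHomSpace L) φ)
        (k * (p : PosHomSpace L) φ)) (-(k * (p : PosHomSpace L) φ))| ≤ ε / 8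
      rw [abs_le]
      grind
    calc _ ≤ 4 * (ε / 8) := hnorm
      _ < ε := by linarith

theorem exists_countable_separating {p : FBL L} (hp : IsQuasiInteriorPoint p) :
    ∃ S : Set L, S.Countable ∧ IsSeparatingSubset S := by
  obtain ⟨S, hS, hpS⟩ := mem_iff.1 p.2 _ isClosedVectorSublattice_countablyDetermined
    fun x => ⟨{x}, Set.countable_singleton x, fun φ h => h x rfl⟩
  refine ⟨S, hS, fun φ ⟨a, ha⟩ => ?_⟩
  by_contra! hcon
  have hpφ := hpS φ hcon
  -- Tolerance `|φ a|`: an ideal element vanishes at `φ`, so it cannot be this close to `δ a`.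
  obtain ⟨f, ⟨c, -, hf⟩, hdist⟩ := Metric.mem_closure_iff.1 (hp.2 (δ a)) |φ a| (abs_pos.2 ha)
  have hfφ : (f : PosHomSpace L) φ = 0 := by
    have h1 : |(f : PosHomSpace L) φ| ≤ c * (p : PosHomSpace L) φ := le_def.1 hf φ
    rw [hpφ, mul_zero] at h1
    exact abs_nonpos_iff.1 h1
  rw [dist_eq_norm] at hdist
  have h2 : |φ a - (f : PosHomSpace L) φ| ≤ ‖δ a - f‖ :=
    abs_apply_le_norm ((δ a - f : FBL L) : PosHomSpace L) φ
  rw [hfφ, sub_zero] at h2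
  exact absurd hdist h2.not_gt

theorem norm_δ_le_one (x : L) : ‖(δ x : FBL L)‖ ≤ 1 :=
  normFn_le fun _ _ hφ => hφ x

theorem exists_hasSum_isQuasiInteriorPoint [Nonempty L] {s : ℕ → L}
    (hs : IsSeparatingSubset (Set.range s)) :
    ∃ p : FBL L, HasSum (fun n : ℕ => ((1 / 2 : ℝ) ^ (n + 1)) • |FBL.δ (s n)|) p ∧
      IsQuasiInteriorPoint p := by
  have hsum : Summable fun n : ℕ => ((1 / 2 : ℝ) ^ (n + 1)) • |(FBL.δ (s n) : FBL L)| := by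
    refine Summable.of_norm_bounded (g := fun n : ℕ => (1 / 2 : ℝ) ^ (n + 1))
      ((summable_nat_add_iff 1).2 summable_geometric_two) fun n => ?_
    rw [norm_smul, norm_abs_eq_norm, Real.norm_of_nonneg (by positivity)]
    exact mul_le_of_le_one_right (by positivity) (norm_δ_le_one _)
  obtain ⟨p, hp⟩ := hsum
  have hnonneg : ∀ n : ℕ, 0 ≤ ((1 / 2 : ℝ) ^ (n + 1)) • |(FBL.δ (s n) : FBL L)| :=
    fun n => smul_nonneg (by positivity) (abs_nonneg _)
  have hp0 : 0 ≤ p := hp.nonneg hnonneg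
  refine ⟨p, hp, isQuasiInteriorPoint_of_eval_mem hp0
    (eval_mem_almostDominated (p := (p : PosHomSpace L)) hp0 hs fun n => ⟨2 ^ (n + 1), fun φ => ?_⟩)⟩
  -- All terms are non-negative, so each lies below the sum.
  have h1 : (1 / 2 : ℝ) ^ (n + 1) * |φ (s n)| ≤ (p : PosHomSpace L) φ :=
    le_def.1 (le_hasSum hp n fun j _ => hnonneg j) φ
  calc |φ (s n)| = 2 ^ (n + 1) * ((1 / 2 : ℝ) ^ (n + 1) * |φ (s n)|) := by
        rw [← mul_assoc, ← mul_pow]; norm_num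
    _ ≤ 2 ^ (n + 1) * (p : PosHomSpace L) φ := by gcongr

end FBL

theorem theorem6p1 {L : Type u} [DistribLattice L] [Nonempty L] :
    ((∃ p : FBL L, IsQuasiInteriorPoint p) ↔
      ∃ S : Set L, S.Countable ∧ IsSeparatingSubset S) ∧
    (∀ s : ℕ → L, IsSeparatingSubset (Set.range s) →
      ∃ p : FBL L, HasSum (fun n : ℕ => ((1 / 2 : ℝ) ^ (n + 1)) • |FBL.δ (s n)|) p ∧
        IsQuasiInteriorPoint p) := by
  refine ⟨⟨fun ⟨p, hp⟩ => FBL.exists_countable_separating hp, fun ⟨S, hS, hsep⟩ => ?_⟩,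
    fun s hs => FBL.exists_hasSum_isQuasiInteriorPoint hs⟩
  -- An extra point makes the set visibly non-empty, hence the range of a sequence, and keeps it
  -- separating.
  obtain ⟨s, hs⟩ := (hS.insert (Classical.arbitrary L)).exists_eq_range (Set.insert_nonempty _ _)
  obtain ⟨p, -, hp⟩ := FBL.exists_hasSum_isQuasiInteriorPoint (s := s) fun φ hφ => by
    obtain ⟨a, ha, h⟩ := hsep φ hφ
    exact ⟨a, hs ▸ Set.mem_insert_of_mem _ ha, h⟩
  exact ⟨p, hp⟩
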